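/- Let $(S,\rho)$ be a compact metric space, and let $s_\alpha\notin S$ be an additional point, with $\rho$ extended to a metric on $S\cup\{s_\alpha\}$, such that $\alpha=\inf_{s\in S}\rho(s,s_\alpha)$ (hence $\alpha>0$ if $S\neq\emptyset$). Let $\mathfrak N$ be the set of finite counting measures $\mu=\sum_{i=1}^n\delta_{x_i}$ on $S$ ($n\ge 0$, $x_i\in S$, repetitions allowed), and write $|\mu|=n$. Equip $\mathfrak N$ with the vague topology $\mathcal T$, i.e. the coarsest topology making $\mu\mapsto\int f\,d\mu$ continuous for every continuous, compactly supported $f:S\to\mathbb R$, and with its Borel $\sigma$-algebra. For $\mu_1=\sum_{i=1}^n\delta_{x_i}$ and $\mu_2=\sum_{i=1}^m\delta_{y_i}$ with $n\le m$ put $$D_1(\mu_1,\mu_2)=D_1(\mu_2,\mu_1)=\min_{\pi}\Big[\sum_{i=1}^n\rho(x_i,y_{\pi(i)})+\sum_{i=n+1}^m\rho(s_\alpha,y_{\pi(i)})\Big],$$ the minimum being over all permutations $\pi$ of $\{1,\dots,m\}$. Let $p\in[1,\infty)$ and, for Borel probability measures $Q_1,Q_2$ on $\mathfrak N$, let $$W_p(Q_1,Q_2)=\Big(\inf_{\gamma}\int_{\mathfrak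 N\times\mathfrak N}D_1(\mu,\nu)^p\,d\gamma(\mu,\nu)\Big)^{1/p}\in[0,\infty],$$ the infimum being over all measures $\gamma$ on $\mathfrak N\times\mathfrak N$ with marginals $Q_1$ and $Q_2$. Let $\eta$ and $\eta_n$, $n\in\mathbb N$, be point processes, i.e. random elements of $\mathfrak N$ (possibly defined on different probability spaces), and let $\mathcal L(\cdot)$ denote the law of a random element. (i) If $W_p^p(\mathcal L(\eta_n),\mathcal L(\eta))\to0$ as $n\to\infty$, then $\eta_n$ converges weakly to $\eta$, i.e. $E[f(\eta_n)]\to E[f(\eta)]$ for every bounded continuous $f:(\mathfrak N,\mathcal T)\to\mathbb R$. (ii) Conversely, if $\sup_n\sum_{i=0}^\infty i^{p_1}P(|\eta_n|=i)<\infty$ for some $p_1>p$ and $\eta_n$ converges weakly to $\eta$, then $W_p^p(\mathcal L(\eta_n),\mathcal L(\eta))\to0$. -/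

import Mathlib

open MeasureTheory Filter Topology
open scoped ENNReal

/-- Finite counting measures on `S`: finite sums `δ_{x₁} + ⋯ + δ_{xₙ}` of Dirac measures, `n ≥ 0`
(points may be repeated). -/
@[ext]
structure CountingMeasure (S : Type*) [MeasurableSpace S] where
  /-- The underlying measure. -/
  toMeasure : Measure S
  exists_points : ∃ (n : ℕ) (x : Fin n → S), toMeasure = ∑ i, Measure.dirac (x i)

namespace CountingMeasure

noncomputable section

section Basic

variable {S : Type*} [MeasurableSpace S]

/-- The number of points `|μ|`, counted with multiplicity. -/
def card (μ : CountingMeasure S) : ℕ := μ.exists_points.choose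

/-- An enumeration of the points of `μ`, with multiplicity. -/
def points (μ : CountingMeasure S) : Fin μ.card → S := μ.exists_points.choose_spec.choose

theorem toMeasure_eq_sum_dirac (μ : CountingMeasure S) :
    μ.toMeasure = ∑ i, Measure.dirac (μ.points i) :=
  μ.exists_points.choose_spec.choose_spec

theorem toMeasure_univ (μ : CountingMeasure S) : μ.toMeasure Set.univ = μ.card := by
  rw [toMeasure_eq_sum_dirac]
  simp [Measure.finsetSum_apply]

/-- The vague topology: the coarsest topology for which `μ ↦ ∫ f dμ` is continuous for every
continuous compactly supported `f : S → ℝ`. -/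
instance [TopologicalSpace S] : TopologicalSpace (CountingMeasure S) :=
  ⨅ f : CompactlySupportedContinuousMap S ℝ,
    TopologicalSpace.induced (fun μ : CountingMeasure S => ∫ s, f s ∂μ.toMeasure) inferInstance

/-- The Borel σ-algebra of the vague topology. -/
instance [TopologicalSpace S] : MeasurableSpace (CountingMeasure S) := borel _

instance [TopologicalSpace S] : BorelSpace (CountingMeasure S) := ⟨rfl⟩

/-- The points of `μ`, viewed in `X` through `ι : S → X`, followed by copies of `sα`. -/
def pad {X : Type*} (ι : S → X) (sα : X) (μ : CountingMeasure S) (m : ℕ) (i : Fin m) : X :=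
  if h : (i : ℕ) < μ.card then ι (μ.points ⟨i, h⟩) else sα

/-- The distance `D₁`. The measure with fewer points is completed with copies of `sα`, so that both
have `max |μ| |ν|` points; the one with more points is left unchanged. Then the total distance of a
matching is minimized over the (finitely many) permutations. -/
def D₁ {X : Type*} [MetricSpace X] (ι : S → X) (sα : X) (μ ν : CountingMeasure S) : ℝ :=
  ⨅ π : Equiv.Perm (Fin (max μ.card ν.card)),
    ∑ i, dist (μ.pad ι sα (max μ.card ν.card) i) (ν.pad ι sα (max μ.card ν.card) (π i))

end Basic

/-- The Wasserstein distance of order `p` built on `D₁`, with values in `[0, ∞]`: the infimum runs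
over the measures `γ` on the product with marginals `Q₁` and `Q₂`. -/
def wasserstein {S X : Type*} [TopologicalSpace S] [MeasurableSpace S] [MetricSpace X]
    (ι : S → X) (sα : X) (p : ℝ) (Q₁ Q₂ : Measure (CountingMeasure S)) : ℝ≥0∞ :=
  (⨅ (γ : Measure (CountingMeasure S × CountingMeasure S))
      (_ : γ.map Prod.fst = Q₁ ∧ γ.map Prod.snd = Q₂),
    ∫⁻ z, ENNReal.ofReal (D₁ ι sα z.1 z.2) ^ p ∂γ) ^ (1 / p)

end

end CountingMeasure

/-!
The space of finite counting measures is the disjoint union of the open and closed pieces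
`{|μ| = n}`, and the enumeration map `ofPoints` exhibits each piece as a continuous image of the
compact space `Sⁿ`. On such an image `D₁` is the quotient of the `ℓ¹`-distance under permutations,
and two measures with different numbers of points are at least `dist(S, sα) > 0` apart
(`card_eq_of_D₁_lt`). Hence `D₁` is jointly continuous (`continuous_D₁`), and a continuous function
is uniformly continuous with respect to `D₁` on measures with boundedly many points
(`exists_pos_forall_D₁_lt`). The vague topology is second countable, so that `D₁` is measurable for
the product σ-algebra.

Wasserstein convergence implies weak convergence: under a coupling of small cost, Markov's
inequality makes `D₁` small with high probability, and the limit law has boundedly many points with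
high probability; off the exceptional event a bounded continuous function changes little.

Conversely, `{|μ| ≤ K}` carries a finite continuous partition of unity by functions whose supports
have small `D₁`-diameter (`exists_subpartition_of_unity`). Coupling the two laws independently along
each of its members, up to the smaller mass (`exists_partial_coupling`), has small cost, and by weak
convergence the mass left over tends to at most the probability that the limit has more than `K`
points. This rest is coupled arbitrarily with the correct marginals (`exists_coupling_add`). Its
cost is bounded by moments of order `p` of the numbers of points on an event of small mass, which
are small by the uniform bound on the moments of order `p₁ > p` (`lintegral_card_rpow_le_of_le`).
-/

/-! ### Finite counting measures and their enumerations -/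

/-- Maps whose fibres have equal cardinalities differ by a permutation of the domain. -/
theorem exists_perm_comp_eq {α β : Type*} [Finite α] {f g : α → β}
    (h : ∀ b, Nat.card {a // f a = b} = Nat.card {a // g a = b}) :
    ∃ σ : Equiv.Perm α, f = g ∘ σ := by
  have e : ∀ b, {a // f a = b} ≃ {a // g a = b} := fun b => (Finite.card_eq.1 (h b)).some
  refine ⟨(Equiv.sigmaFiberEquiv f).symm.trans
    ((Equiv.sigmaCongrRight e).trans (Equiv.sigmaFiberEquiv g)), ?_⟩
  funext a
  exact (e (f a) ⟨a, rfl⟩).2.symm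

namespace CountingMeasure

section Points

variable {S : Type*} [MeasurableSpace S]

/-- The counting measure `∑ i, δ_{x i}` of a tuple `x`. -/
noncomputable def ofPoints {n : ℕ} (x : Fin n → S) : CountingMeasure S :=
  ⟨∑ i, Measure.dirac (x i), n, x, rfl⟩

theorem ofPoints_points (μ : CountingMeasure S) : ofPoints μ.points = μ :=
  CountingMeasure.ext μ.toMeasure_eq_sum_dirac.symm

@[simp]
theorem card_ofPoints {n : ℕ} (x : Fin n → S) : (ofPoints x).card = n := by
  have h := toMeasure_univ (ofPoints x)
  simp only [ofPoints, Measure.finsetSum_apply, measure_univ, Finset.sum_const, Finset.card_univ,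
    Fintype.card_fin, nsmul_eq_mul, mul_one] at h
  exact_mod_cast h.symm

theorem exists_ofPoints_eq {μ : CountingMeasure S} {n : ℕ} (h : μ.card = n) :
    ∃ x : Fin n → S, ofPoints x = μ := by
  subst h
  exact ⟨μ.points, μ.ofPoints_points⟩

theorem ofPoints_comp_perm {n : ℕ} (x : Fin n → S) (σ : Equiv.Perm (Fin n)) :
    ofPoints (x ∘ σ) = ofPoints x :=
  CountingMeasure.ext (Equiv.sum_comp σ fun i => Measure.dirac (x i))

/-- A finite counting measure determines its points up to their order, because the multiplicity of
a point is the mass of its singleton. -/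
theorem exists_perm_of_ofPoints_eq [MeasurableSingletonClass S] {n : ℕ} {x y : Fin n → S}
    (h : ofPoints x = ofPoints y) : ∃ σ : Equiv.Perm (Fin n), x = y ∘ σ := by
  classical
  have key : ∀ (z : Fin n → S) (s : S),
      (ofPoints z).toMeasure {s} = (Nat.card {i // z i = s} : ℕ) := by
    intro z s
    rw [Nat.card_eq_fintype_card, Fintype.card_subtype]
    simp [ofPoints, Measure.finsetSum_apply, Set.indicator_apply]
  refine exists_perm_comp_eq fun s => ?_
  have := (key x s).symm.trans ((congrArg (fun μ => μ.toMeasure {s}) h).trans (key y s))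
  exact_mod_cast this

theorem integral_ofPoints [MeasurableSingletonClass S] {n : ℕ} (x : Fin n → S) (f : S → ℝ) :
    ∫ s, f s ∂(ofPoints x).toMeasure = ∑ i, f (x i) := by
  simp only [ofPoints]
  rw [integral_finsetSum_measure fun i _ => integrable_dirac (by simp)]
  simp

instance (μ : CountingMeasure S) : IsFiniteMeasure μ.toMeasure :=
  ⟨by rw [toMeasure_univ]; exact ENNReal.natCast_lt_top _⟩

end Points

/-! ### The distance `D₁` in terms of tuples of points -/

section Dist

variable {S X : Type*}

/-- The tuple `x` in `S`, viewed in `X` and completed with copies of `sα` to length `k`. -/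
def padTuple (ι : S → X) (sα : X) {n : ℕ} (x : Fin n → S) (k : ℕ) (i : Fin k) : X :=
  if h : (i : ℕ) < n then ι (x ⟨i, h⟩) else sα

theorem padTuple_self (ι : S → X) (sα : X) {n : ℕ} (x : Fin n → S) (i : Fin n) :
    padTuple ι sα x n i = ι (x i) := by
  simp [padTuple]

theorem padTuple_mem (ι : S → X) (sα : X) {n : ℕ} (x : Fin n → S) (k : ℕ) (i : Fin k) :
    padTuple ι sα x k i ∈ insert sα (Set.range ι) := by
  unfold padTuple
  split_ifs <;> simp

theorem exists_perm_padTuple_comp (ι : S → X) (sα : X) {n k : ℕ} (hnk : n ≤ k) (x : Fin n → S)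
    (σ : Equiv.Perm (Fin n)) :
    ∃ τ : Equiv.Perm (Fin k), padTuple ι sα (x ∘ σ) k = padTuple ι sα x k ∘ τ := by
  refine ⟨σ.viaFintypeEmbedding (Fin.castLEEmb hnk), ?_⟩
  funext i
  by_cases hi : (i : ℕ) < n
  · have hi' : i = Fin.castLEEmb hnk ⟨i, hi⟩ := by ext; simp
    rw [Function.comp_apply, hi', Equiv.Perm.viaFintypeEmbedding_apply_image]
    simp [padTuple, hi]
  · have hi' : i ∉ Set.range (Fin.castLEEmb hnk) := by
      rintro ⟨j, rfl⟩
      exact hi (by simp)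
    rw [Function.comp_apply, Equiv.Perm.viaFintypeEmbedding_apply_notMem_range _ _ hi']
    simp [padTuple, hi]

variable [MetricSpace X]

theorem iInf_perm_sum_dist_comp {k : ℕ} (a b : Fin k → X) (σ τ : Equiv.Perm (Fin k)) :
    ⨅ π : Equiv.Perm (Fin k), ∑ i, dist ((a ∘ σ) i) ((b ∘ τ) (π i)) =
      ⨅ π : Equiv.Perm (Fin k), ∑ i, dist (a i) (b (π i)) := by
  refine Equiv.iInf_congr ((Equiv.mulLeft τ).trans (Equiv.mulRight σ⁻¹)) fun π => ?_
  rw [← Equiv.sum_comp σ]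
  simp

variable [MeasurableSpace S]

/-- `D₁` may be computed from any enumerations of the points of the two measures. -/
theorem D₁_ofPoints [MeasurableSingletonClass S] (ι : S → X) (sα : X) {n m k : ℕ}
    (hk : max n m = k) (x : Fin n → S) (y : Fin m → S) :
    D₁ ι sα (ofPoints x) (ofPoints y) =
      ⨅ π : Equiv.Perm (Fin k), ∑ i, dist (padTuple ι sα x k i) (padTuple ι sα y k (π i)) := by
  subst hk
  generalize hμ : ofPoints x = μ
  generalize hν : ofPoints y = ν
  obtain rfl : μ.card = n := by rw [← hμ, card_ofPoints]
  obtain rfl : ν.card = m := by rw [← hν, card_ofPoints]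
  obtain ⟨σ, hσ⟩ := exists_perm_of_ofPoints_eq (hμ.trans μ.ofPoints_points.symm)
  obtain ⟨τ, hτ⟩ := exists_perm_of_ofPoints_eq (hν.trans ν.ofPoints_points.symm)
  obtain ⟨σ', hσ'⟩ := exists_perm_padTuple_comp ι sα (le_max_left μ.card ν.card) μ.points σ
  obtain ⟨τ', hτ'⟩ := exists_perm_padTuple_comp ι sα (le_max_right μ.card ν.card) ν.points τ
  rw [hσ, hτ, hσ', hτ', iInf_perm_sum_dist_comp]
  rfl

theorem D₁_nonneg (ι : S → X) (sα : X) (μ ν : CountingMeasure S) : 0 ≤ D₁ ι sα μ ν :=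
  Real.iInf_nonneg fun _ => Finset.sum_nonneg fun _ _ => dist_nonneg

/-- The minimum in the definition of `D₁` is attained: measures with equally many points can be
enumerated so that `D₁` is the total distance of corresponding points. -/
theorem exists_ofPoints_D₁_eq [PseudoMetricSpace S] [MeasurableSingletonClass S] {ι : S → X}
    (hι : Isometry ι) (sα : X) {n : ℕ} {μ : CountingMeasure S} (x : Fin n → S)
    (hμ : μ.card = n) :
    ∃ y : Fin n → S, ofPoints y = μ ∧ D₁ ι sα (ofPoints x) μ = ∑ i, dist (x i) (y i) := by
  obtain ⟨y, rfl⟩ := exists_ofPoints_eq hμ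
  obtain ⟨π, hπ⟩ := exists_eq_ciInf_of_finite (f := fun π : Equiv.Perm (Fin n) =>
    ∑ i, dist (padTuple ι sα x n i) (padTuple ι sα y n (π i)))
  refine ⟨y ∘ π, ofPoints_comp_perm y π, ?_⟩
  rw [D₁_ofPoints ι sα (max_self n), ← hπ]
  simp [padTuple_self, hι.dist_eq]

theorem D₁_ofPoints_le [PseudoMetricSpace S] [MeasurableSingletonClass S] {ι : S → X}
    (hι : Isometry ι) (sα : X) {n : ℕ} (x y : Fin n → S) :
    D₁ ι sα (ofPoints x) (ofPoints y) ≤ ∑ i, dist (x i) (y i) := by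
  rw [D₁_ofPoints ι sα (max_self n)]
  refine (ciInf_le (Set.finite_range _).bddBelow 1).trans_eq ?_
  simp [padTuple_self, hι.dist_eq]

theorem D₁_self [PseudoMetricSpace S] [MeasurableSingletonClass S] {ι : S → X}
    (hι : Isometry ι) (sα : X) (μ : CountingMeasure S) : D₁ ι sα μ μ = 0 := by
  refine le_antisymm ?_ (D₁_nonneg _ _ _ _)
  have := D₁_ofPoints_le hι sα μ.points μ.points
  simpa [ofPoints_points] using this

theorem D₁_le_add_of_card_eq [PseudoMetricSpace S] [MeasurableSingletonClass S] {ι : S → X}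
    (hι : Isometry ι) (sα : X) {μ ν ξ : CountingMeasure S} (hμ : μ.card = ξ.card)
    (hν : ν.card = ξ.card) :
    D₁ ι sα μ ν ≤ D₁ ι sα ξ μ + D₁ ι sα ξ ν := by
  obtain ⟨n, hn⟩ : ∃ n, ξ.card = n := ⟨_, rfl⟩
  obtain ⟨x, rfl⟩ := exists_ofPoints_eq hn
  obtain ⟨y, rfl, hy⟩ := exists_ofPoints_D₁_eq hι sα x (hμ.trans hn)
  obtain ⟨z, rfl, hz⟩ := exists_ofPoints_D₁_eq hι sα x (hν.trans hn)
  rw [hy, hz, ← Finset.sum_add_distrib]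
  exact (D₁_ofPoints_le hι sα y z).trans
    (Finset.sum_le_sum fun i _ => dist_triangle_left _ _ _)

/-- Measures with different numbers of points are at least `a` apart, where `a` bounds the distance
of `sα` to `S` from below: some point of the larger one is matched with `sα`. -/
theorem card_eq_of_D₁_lt {ι : S → X} {sα : X} {a : ℝ} (ha : ∀ s, a ≤ dist (ι s) sα)
    {μ ν : CountingMeasure S} (h : D₁ ι sα μ ν < a) : μ.card = ν.card := by
  by_contra hne
  unfold D₁ at h
  set k := max μ.card ν.card with hk
  refine h.not_ge (le_ciInf fun π => ?_)
  suffices ∃ i, a ≤ dist (μ.pad ι sα k i) (ν.pad ι sα k (π i)) by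
    obtain ⟨i, hi⟩ := this
    exact hi.trans (Finset.single_le_sum
      (f := fun i => dist (μ.pad ι sα k i) (ν.pad ι sα k (π i)))
      (fun _ _ => dist_nonneg) (Finset.mem_univ i))
  rcases lt_or_gt_of_ne hne with hlt | hlt
  · have hk' : k = ν.card := max_eq_right hlt.le
    have hi : ((π ⟨μ.card, by omega⟩ : Fin k) : ℕ) < ν.card := by
      rw [← hk']; exact Fin.is_lt _
    refine ⟨⟨μ.card, by omega⟩, ?_⟩
    rw [dist_comm]
    simpa [pad, hi] using ha _
  · have hk' : k = μ.card := max_eq_left hlt.le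
    have hi : ((π.symm ⟨ν.card, by omega⟩ : Fin k) : ℕ) < μ.card := by
      rw [← hk']; exact Fin.is_lt _
    refine ⟨π.symm ⟨ν.card, by omega⟩, ?_⟩
    simpa [pad, hi] using ha _

theorem D₁_le_mul_max {ι : S → X} {sα : X} {C : ℝ}
    (hC : ∀ u ∈ insert sα (Set.range ι), ∀ v ∈ insert sα (Set.range ι), dist u v ≤ C)
    (μ ν : CountingMeasure S) :
    D₁ ι sα μ ν ≤ C * max μ.card ν.card := by
  refine (ciInf_le (Set.finite_range _).bddBelow 1).trans ?_
  refine (Finset.sum_le_card_nsmul _ _ C fun i _ => ?_).trans_eq ?_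
  · exact hC _ (padTuple_mem ι sα μ.points _ i) _ (padTuple_mem ι sα ν.points _ _)
  · simp [mul_comm]

end Dist

end CountingMeasure

/-! ### The vague topology -/

namespace CountingMeasure

section Vague

variable {S : Type*} [MetricSpace S] [CompactSpace S] [MeasurableSpace S] [BorelSpace S]

omit [BorelSpace S] in
theorem continuous_integral (f : C(S, ℝ)) :
    Continuous fun μ : CountingMeasure S => ∫ s, f s ∂μ.toMeasure := by
  let g : CompactlySupportedContinuousMap S ℝ := ⟨f, HasCompactSupport.of_compactSpace f⟩
  exact continuous_iff_le_induced.2 (iInf_le (fun h : CompactlySupportedContinuousMap S ℝ =>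
    TopologicalSpace.induced (fun μ : CountingMeasure S => ∫ s, h s ∂μ.toMeasure) inferInstance) g)

omit [MetricSpace S] [CompactSpace S] [BorelSpace S] in
theorem integral_one (μ : CountingMeasure S) : ∫ _, (1 : ℝ) ∂μ.toMeasure = μ.card := by
  simp [Measure.real, toMeasure_univ]

omit [BorelSpace S] in
theorem continuous_card : Continuous (card : CountingMeasure S → ℕ) := by
  rw [Nat.isClosedEmbedding_coe_real.isInducing.continuous_iff]
  refine (continuous_integral (S := S) 1).congr fun μ => ?_
  exact integral_one μ

omit [BorelSpace S] in
theorem isOpen_card_eq (n : ℕ) : IsOpen {μ : CountingMeasure S | μ.card = n} :=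
  (isOpen_discrete {n}).preimage continuous_card

theorem continuous_ofPoints (n : ℕ) :
    Continuous (ofPoints : (Fin n → S) → CountingMeasure S) := by
  refine continuous_iInf_rng.2 fun f => continuous_induced_rng.2 ?_
  simp only [Function.comp_def, integral_ofPoints]
  exact continuous_finsetSum _ fun i _ => f.continuous.comp (continuous_apply i)

instance : T2Space (CountingMeasure S) := by
  refine T2Space.of_injective_continuous
    (f := fun (μ : CountingMeasure S) (f : C(S, ℝ)) => ∫ s, f s ∂μ.toMeasure) ?_
    (continuous_pi continuous_integral)
  intro μ ν h
  refine CountingMeasure.ext (ext_of_forall_integral_eq_of_IsFiniteMeasure fun f => ?_)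
  exact congrFun h f.toContinuousMap

/-- The vague topology is generated by the integrals of countably many functions: the constant `1`,
which makes the number of points continuous, and a dense sequence of `C(S, ℝ)`, because an integral
depends uniformly on the integrand as long as the number of points is fixed. -/
instance : SecondCountableTopology (CountingMeasure S) := by
  obtain ⟨D, hDc, hDd⟩ := TopologicalSpace.exists_countable_dense C(S, ℝ)
  have : Countable (insert 1 D : Set C(S, ℝ)) := (hDc.insert 1).to_subtype
  let t (f : C(S, ℝ)) : TopologicalSpace (CountingMeasure S) :=
    TopologicalSpace.induced (fun μ => ∫ s, f s ∂μ.toMeasure) inferInstance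
  let t' : TopologicalSpace (CountingMeasure S) := ⨅ f : (insert 1 D : Set C(S, ℝ)), t f
  have hcont : ∀ f ∈ insert 1 D, Continuous[t', _] fun μ => ∫ s, f s ∂μ.toMeasure :=
    fun f hf => continuous_iff_le_induced.2
      (iInf_le (fun f : (insert 1 D : Set C(S, ℝ)) => t f) ⟨f, hf⟩)
  have hcard : Continuous[t', _] fun μ : CountingMeasure S => (μ.card : ℝ) :=
    @Continuous.congr _ _ t' _ _ _ (hcont 1 (Set.mem_insert _ _)) integral_one
  have heq : (instTopologicalSpace : TopologicalSpace (CountingMeasure S)) = t' := by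
    refine le_antisymm (le_iInf fun f => continuous_iff_le_induced.1 (continuous_integral f.1)) ?_
    refine le_iInf fun (f : CompactlySupportedContinuousMap S ℝ) =>
      continuous_iff_le_induced.1 ?_
    rw [@continuous_iff_continuousAt _ _ t' _]
    intro μ
    rw [@Metric.continuousAt_iff' _ _ _ t']
    intro ε hε
    have hpos : 0 < ε / (3 * (μ.card + 1)) := by positivity
    obtain ⟨g, hgD, hg⟩ := hDd.exists_dist_lt f.toContinuousMap hpos
    have h1 := (@Metric.continuousAt_iff' _ _ _ t' _ _).1
      ((@continuous_iff_continuousAt _ _ t' _ _).1 hcard μ) 1 one_pos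
    have h2 := (@Metric.continuousAt_iff' _ _ _ t' _ _).1
      ((@continuous_iff_continuousAt _ _ t' _ _).1 (hcont g (Set.mem_insert_of_mem _ hgD)) μ)
      (ε / 3) (by positivity)
    filter_upwards [h1, h2] with ν hν1 hν2
    have hc : ν.card = μ.card := by
      rw [Real.dist_eq] at hν1
      have : |(ν.card : ℤ) - μ.card| < 1 := by exact_mod_cast hν1
      have := abs_lt.1 this
      omega
    have key : ∀ ξ : CountingMeasure S, ξ.card = μ.card →
        |∫ s, f s ∂ξ.toMeasure - ∫ s, g s ∂ξ.toMeasure| ≤ ε / 3 := by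
      intro ξ hξ
      obtain ⟨x, rfl⟩ := exists_ofPoints_eq hξ
      rw [integral_ofPoints, integral_ofPoints, ← Finset.sum_sub_distrib]
      refine (Finset.abs_sum_le_sum_abs _ _).trans ?_
      refine (Finset.sum_le_card_nsmul _ _ (ε / (3 * (μ.card + 1))) fun i _ => ?_).trans ?_
      · exact (ContinuousMap.dist_apply_le_dist (f := f.toContinuousMap) (g := g) (x i)).trans hg.le
      · simp only [Finset.card_univ, Fintype.card_fin, nsmul_eq_mul]
        rw [mul_div_assoc', div_le_div_iff₀ (by positivity) (by positivity)]
        nlinarith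
    have k1 := abs_le.1 (key ν hc)
    have k2 := abs_le.1 (key μ rfl)
    rw [Real.dist_eq, abs_lt] at hν2 ⊢
    constructor <;> linarith [k1.1, k1.2, k2.1, k2.2, hν2.1, hν2.2]
  have ht : ∀ f : (insert 1 D : Set C(S, ℝ)), @SecondCountableTopology _ (t f) :=
    fun f => TopologicalSpace.secondCountableTopology_induced _ _ _
  have := TopologicalSpace.secondCountableTopology_iInf
    (t := fun f : (insert 1 D : Set C(S, ℝ)) => t f) ht
  rwa [heq]

theorem isCompact_card_le (K : ℕ) : IsCompact {μ : CountingMeasure S | μ.card ≤ K} := by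
  have : {μ : CountingMeasure S | μ.card ≤ K} =
      ⋃ n ∈ Set.Iic K, Set.range (ofPoints : (Fin n → S) → CountingMeasure S) := by
    ext μ
    simp only [Set.mem_ofPred_eq, Set.mem_iUnion, Set.mem_Iic, exists_prop, Set.mem_range]
    constructor
    · exact fun h => ⟨μ.card, h, _, μ.ofPoints_points⟩
    · rintro ⟨n, hn, x, rfl⟩
      simpa using hn
  rw [this]
  exact (Set.finite_Iic K).isCompact_biUnion fun n _ => isCompact_range (continuous_ofPoints n)

variable {X : Type*} [MetricSpace X]

omit [CompactSpace S] in
theorem continuous_D₁_ofPoints {ι : S → X} (hι : Isometry ι) (sα : X) (n m : ℕ) :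
    Continuous fun z : (Fin n → S) × (Fin m → S) =>
      D₁ ι sα (ofPoints z.1) (ofPoints z.2) := by
  have hpad : ∀ (l k : ℕ) (i : Fin k), Continuous fun x : Fin l → S => padTuple ι sα x k i := by
    intro l k i
    unfold padTuple
    split_ifs with h
    · exact hι.continuous.comp (continuous_apply _)
    · exact continuous_const
  simp only [D₁_ofPoints ι sα rfl, ← Finset.inf'_univ_eq_ciInf]
  refine Continuous.finset_inf'_apply _ fun π _ => continuous_finsetSum _ fun i _ => ?_
  exact ((hpad _ _ _).comp continuous_fst).dist ((hpad _ _ _).comp continuous_snd)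

/-- `D₁` is jointly continuous for the vague topology: the enumeration maps from the compact
powers of `S` are closed, and their ranges are open. -/
theorem continuous_D₁ {ι : S → X} (hι : Isometry ι) (sα : X) :
    Continuous fun z : CountingMeasure S × CountingMeasure S => D₁ ι sα z.1 z.2 := by
  refine continuous_iff_isClosed.2 fun F hF => ?_
  let T (k : ℕ × ℕ) (z : (Fin k.1 → S) × (Fin k.2 → S)) :
      CountingMeasure S × CountingMeasure S := (ofPoints z.1, ofPoints z.2)
  have hT : ∀ k, Continuous (T k) := fun k =>
    ((continuous_ofPoints _).comp continuous_fst).prodMk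
      ((continuous_ofPoints _).comp continuous_snd)
  have hcov : (fun z : CountingMeasure S × CountingMeasure S => D₁ ι sα z.1 z.2) ⁻¹' F =
      ⋃ k, T k '' ((fun z => D₁ ι sα (ofPoints z.1) (ofPoints z.2)) ⁻¹' F) := by
    ext ⟨μ, ν⟩
    simp only [Set.mem_preimage, Set.mem_iUnion, Set.mem_image, Prod.exists]
    constructor
    · intro h
      exact ⟨μ.card, ν.card, μ.points, ν.points, by simpa [ofPoints_points] using h,
        by simp [T, ofPoints_points]⟩
    · rintro ⟨n, m, x, y, h, hxy⟩
      obtain ⟨rfl, rfl⟩ := Prod.mk.inj hxy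
      exact h
  rw [hcov]
  refine LocallyFinite.isClosed_iUnion ?_ fun k =>
    (hT k).isClosedMap _ (hF.preimage (continuous_D₁_ofPoints hι sα _ _))
  rintro ⟨μ, ν⟩
  refine ⟨{ξ | ξ.card = μ.card} ×ˢ {ξ | ξ.card = ν.card},
    ((isOpen_card_eq _).prod (isOpen_card_eq _)).mem_nhds ⟨rfl, rfl⟩, ?_⟩
  refine (Set.finite_singleton (μ.card, ν.card)).subset ?_
  rintro ⟨n, m⟩ ⟨_, ⟨⟨x, y⟩, -, rfl⟩, h1, h2⟩
  simp only [T, Set.mem_ofPred_eq, card_ofPoints] at h1 h2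
  simp [h1, h2]

/-- A continuous function on counting measures is uniformly continuous with respect to `D₁` on
measures with boundedly many points. -/
theorem exists_pos_forall_D₁_lt {ι : S → X} (hι : Isometry ι) {sα : X} {a : ℝ} (ha0 : 0 < a)
    (ha : ∀ s, a ≤ dist (ι s) sα) {f : CountingMeasure S → ℝ} (hf : Continuous f) (K : ℕ)
    {ε : ℝ} (hε : 0 < ε) :
    ∃ δ > 0, ∀ μ ν : CountingMeasure S, ν.card ≤ K → D₁ ι sα μ ν < δ → |f μ - f ν| < ε := by
  have huc : ∀ n : ℕ, ∃ δ > 0, ∀ x y : Fin n → S, dist x y < δ →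
      dist (f (ofPoints x)) (f (ofPoints y)) < ε := fun n => by
    obtain ⟨δ, hδ, h⟩ := Metric.uniformContinuous_iff.1
      (CompactSpace.uniformContinuous_of_continuous (hf.comp (continuous_ofPoints n))) ε hε
    exact ⟨δ, hδ, fun x y hxy => h hxy⟩
  choose δ hδ h using huc
  have hne : (Finset.range (K + 1)).Nonempty := ⟨0, by simp⟩
  refine ⟨min a ((Finset.range (K + 1)).inf' hne δ), lt_min ha0 ?_, fun μ ν hν hD => ?_⟩
  · simpa using fun n _ => hδ n
  have hcard := card_eq_of_D₁_lt ha (hD.trans_le (min_le_left _ _))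
  obtain ⟨n, hn⟩ : ∃ n, μ.card = n := ⟨_, rfl⟩
  obtain ⟨x, rfl⟩ := exists_ofPoints_eq hn
  obtain ⟨y, rfl, hy⟩ := exists_ofPoints_D₁_eq hι sα x (hcard.symm.trans hn)
  rw [card_ofPoints] at hν
  have hlt : ∑ i, dist (x i) (y i) < δ n := hy ▸ hD.trans_le ((min_le_right _ _).trans
    (Finset.inf'_le _ (Finset.mem_range.2 (Nat.lt_succ_of_le hν))))
  refine h n x y ((dist_pi_lt_iff (hδ n)).2 fun i => lt_of_le_of_lt ?_ hlt)
  exact Finset.single_le_sum (f := fun i => dist (x i) (y i)) (fun _ _ => dist_nonneg)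
    (Finset.mem_univ i)

omit [MeasurableSpace S] [BorelSpace S] in
/-- The range of `ι` is compact, hence at positive distance from `sα`. -/
theorem exists_pos_forall_le_dist {ι : S → X} (hι : Isometry ι) {sα : X}
    (hsα : sα ∉ Set.range ι) : ∃ a > 0, ∀ s, a ≤ dist (ι s) sα := by
  obtain ⟨ε, hε, h⟩ := Metric.isOpen_iff.1 (isCompact_range hι.continuous).isClosed.isOpen_compl
    sα hsα
  exact ⟨ε, hε, fun s => not_lt.1 fun hs => h hs ⟨s, rfl⟩⟩

end Vague

end CountingMeasure

/-! ### Couplings -/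

section Coupling

variable {E : Type*} [MeasurableSpace E]

/-- A measure on the product whose marginals are dominated by those prescribed extends to a
coupling: the defects of the marginals have equal mass, and their normalized product is added. -/
theorem exists_coupling_add (Q₁ Q₂ : Measure E) [IsProbabilityMeasure Q₁]
    [IsProbabilityMeasure Q₂] {γ₀ : Measure (E × E)} (h₁ : γ₀.map Prod.fst ≤ Q₁)
    (h₂ : γ₀.map Prod.snd ≤ Q₂) :
    ∃ R : Measure (E × E), (γ₀ + R).map Prod.fst = Q₁ ∧ (γ₀ + R).map Prod.snd = Q₂ ∧
      R.map Prod.fst ≤ Q₁ ∧ R.map Prod.snd ≤ Q₂ ∧ R Set.univ = 1 - γ₀ Set.univ := by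
  have hf1 : IsFiniteMeasure (γ₀.map Prod.fst) := isFiniteMeasure_of_le Q₁ h₁
  have hf2 : IsFiniteMeasure (γ₀.map Prod.snd) := isFiniteMeasure_of_le Q₂ h₂
  set R₁ := Q₁ - γ₀.map Prod.fst with hR₁
  set R₂ := Q₂ - γ₀.map Prod.snd with hR₂
  have hf3 : IsFiniteMeasure R₁ := isFiniteMeasure_of_le Q₁ Measure.sub_le
  have hf4 : IsFiniteMeasure R₂ := isFiniteMeasure_of_le Q₂ Measure.sub_le
  set r := 1 - γ₀ Set.univ
  have hr1 : R₁ Set.univ = r := by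
    rw [hR₁, Measure.sub_apply MeasurableSet.univ h₁, Measure.map_apply measurable_fst .univ,
      measure_univ, Set.preimage_univ]
  have hr2 : R₂ Set.univ = r := by
    rw [hR₂, Measure.sub_apply MeasurableSet.univ h₂, Measure.map_apply measurable_snd .univ,
      measure_univ, Set.preimage_univ]
  have hrtop : r ≠ ∞ := hr1 ▸ measure_ne_top R₁ _
  -- For `r = 0` the scalar `r⁻¹` is infinite, but the measures are zero.
  have hsmul : ∀ R' : Measure E, R' Set.univ = r → r⁻¹ • r • R' = R' := by
    intro R' hR'
    rcases eq_or_ne r 0 with h0 | h0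
    · rw [h0, Measure.measure_univ_eq_zero] at hR'
      simp [hR']
    · rw [smul_smul, ENNReal.inv_mul_cancel h0 hrtop, one_smul]
  have hm1 : (r⁻¹ • R₁.prod R₂).map Prod.fst = R₁ := by
    rw [Measure.map_smul, Measure.map_fst_prod, hr2, hsmul R₁ hr1]
  have hm2 : (r⁻¹ • R₁.prod R₂).map Prod.snd = R₂ := by
    rw [Measure.map_smul, Measure.map_snd_prod, hr1, hsmul R₂ hr2]
  refine ⟨r⁻¹ • R₁.prod R₂, ?_, ?_, hm1.trans_le Measure.sub_le,
    hm2.trans_le Measure.sub_le, ?_⟩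
  · rw [Measure.map_add _ _ measurable_fst, hm1, add_comm, Measure.sub_add_cancel_of_le h₁]
  · rw [Measure.map_add _ _ measurable_snd, hm2, add_comm, Measure.sub_add_cancel_of_le h₂]
  · have := congrArg (fun μ => μ Set.univ) hm1
    rwa [Measure.map_apply measurable_fst .univ, Set.preimage_univ, hr1] at this

/-- Two measures are coupled partially along a subpartition of unity `φ`: the parts
`φ i • Q₁` and `φ i • Q₂` are coupled independently, up to the smaller of their masses. -/
theorem exists_partial_coupling {ι : Type*} [Fintype ι] (Q₁ Q₂ : Measure E)
    [IsProbabilityMeasure Q₁] [IsProbabilityMeasure Q₂] (φ : ι → E → ℝ≥0∞)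
    (hφ : ∀ i, Measurable (φ i)) (hsum : ∀ x, ∑ i, φ i x ≤ 1) :
    ∃ γ₀ : Measure (E × E), γ₀.map Prod.fst ≤ Q₁ ∧ γ₀.map Prod.snd ≤ Q₂ ∧
      γ₀ Set.univ = ∑ i, min (∫⁻ x, φ i x ∂Q₁) (∫⁻ x, φ i x ∂Q₂) ∧
      ∀ᵐ z ∂γ₀, ∃ i, φ i z.1 ≠ 0 ∧ φ i z.2 ≠ 0 := by
  have hle1 : ∀ i x, φ i x ≤ 1 := fun i x =>
    (Finset.single_le_sum (f := fun i => φ i x) (fun _ _ => zero_le) (Finset.mem_univ i)).trans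
      (hsum x)
  have hmass : ∀ (Q : Measure E) [IsProbabilityMeasure Q] (i : ι), ∫⁻ x, φ i x ∂Q ≠ ∞ := by
    intro Q _ i
    refine ne_top_of_le_ne_top ENNReal.one_ne_top ((lintegral_mono (hle1 i)).trans ?_)
    simp
  have hfin : ∀ (Q : Measure E) [IsProbabilityMeasure Q] (i : ι),
      IsFiniteMeasure (Q.withDensity (φ i)) := fun Q _ i =>
    isFiniteMeasure_withDensity (hmass Q i)
  have htot : ∀ Q : Measure E, ∑ i, Q.withDensity (φ i) ≤ Q := by
    intro Q
    refine Measure.le_iff.2 fun s hs => ?_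
    simp only [Measure.finsetSum_apply, withDensity_apply _ hs]
    rw [← lintegral_finsetSum _ fun i _ => hφ i]
    exact (lintegral_mono hsum).trans (by simp)
  set a : ι → ℝ≥0∞ := fun i => ∫⁻ x, φ i x ∂Q₁ with ha
  set b : ι → ℝ≥0∞ := fun i => ∫⁻ x, φ i x ∂Q₂ with hb
  have hαu : ∀ i, Q₁.withDensity (φ i) Set.univ = a i := fun i => by
    simp [withDensity_apply _ MeasurableSet.univ, ha]
  have hβu : ∀ i, Q₂.withDensity (φ i) Set.univ = b i := fun i => by
    simp [withDensity_apply _ MeasurableSet.univ, hb]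
  -- If one of the masses vanishes, its inverse is infinite, but the minimum is `0`, hence so is
  -- `c i`.
  let c : ι → ℝ≥0∞ := fun i => min (a i) (b i) * ((a i)⁻¹ * (b i)⁻¹)
  have hca : ∀ i, c i * a i ≤ 1 := fun i => calc
    c i * a i = (min (a i) (b i) * (b i)⁻¹) * ((a i)⁻¹ * a i) := by ring
    _ ≤ (b i * (b i)⁻¹) * ((a i)⁻¹ * a i) := by gcongr; exact min_le_right _ _
    _ ≤ 1 * 1 := mul_le_mul' (ENNReal.mul_inv_le_one _) (ENNReal.inv_mul_le_one _)
    _ = 1 := one_mul 1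
  have hcb : ∀ i, c i * b i ≤ 1 := fun i => calc
    c i * b i = (min (a i) (b i) * (a i)⁻¹) * ((b i)⁻¹ * b i) := by ring
    _ ≤ (a i * (a i)⁻¹) * ((b i)⁻¹ * b i) := by gcongr; exact min_le_left _ _
    _ ≤ 1 * 1 := mul_le_mul' (ENNReal.mul_inv_le_one _) (ENNReal.inv_mul_le_one _)
    _ = 1 := one_mul 1
  have hcab : ∀ i, c i * (a i * b i) = min (a i) (b i) := by
    intro i
    rcases eq_or_ne (a i) 0 with h | h
    · simp [c, h]
    rcases eq_or_ne (b i) 0 with h' | h'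
    · simp [c, h']
    calc c i * (a i * b i) = min (a i) (b i) * (((a i)⁻¹ * a i) * ((b i)⁻¹ * b i)) := by ring
      _ = min (a i) (b i) := by
        rw [ENNReal.inv_mul_cancel h (hmass Q₁ i), ENNReal.inv_mul_cancel h' (hmass Q₂ i)]
        simp
  have hsmul_le : ∀ (d : ℝ≥0∞) (ν : Measure E), d ≤ 1 → d • ν ≤ ν := fun d ν hd =>
    Measure.le_iff.2 fun s _ => by
      rw [Measure.smul_apply, smul_eq_mul]
      exact mul_le_of_le_one_left' hd
  refine ⟨∑ i, c i • (Q₁.withDensity (φ i)).prod (Q₂.withDensity (φ i)), ?_, ?_, ?_, ?_⟩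
  · refine le_trans ?_ (htot Q₁)
    rw [Measure.map_finset_sum measurable_fst.aemeasurable]
    refine Finset.sum_le_sum fun i _ => ?_
    rw [Measure.map_smul, Measure.map_fst_prod, hβu, smul_smul]
    exact hsmul_le _ _ (hcb i)
  · refine le_trans ?_ (htot Q₂)
    rw [Measure.map_finset_sum measurable_snd.aemeasurable]
    refine Finset.sum_le_sum fun i _ => ?_
    rw [Measure.map_smul, Measure.map_snd_prod, hαu, smul_smul]
    exact hsmul_le _ _ (hca i)
  · simp only [Measure.finsetSum_apply, Measure.smul_apply, smul_eq_mul]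
    refine Finset.sum_congr rfl fun i _ => ?_
    rw [← Set.univ_prod_univ, Measure.prod_prod, hαu, hβu, hcab]
  · rw [ae_iff]
    simp only [Measure.finsetSum_apply, Measure.smul_apply, smul_eq_mul]
    refine Finset.sum_eq_zero fun i _ => ?_
    have h1 : ∀ᵐ x ∂Q₁.withDensity (φ i), φ i x ≠ 0 :=
      (ae_withDensity_iff (hφ i)).2 (Eventually.of_forall fun _ h => h)
    have h2 : ∀ᵐ x ∂Q₂.withDensity (φ i), φ i x ≠ 0 :=
      (ae_withDensity_iff (hφ i)).2 (Eventually.of_forall fun _ h => h)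
    have h1' := Measure.quasiMeasurePreserving_fst
      (μ := Q₁.withDensity (φ i)) (ν := Q₂.withDensity (φ i)) |>.ae h1
    have h2' := Measure.quasiMeasurePreserving_snd
      (μ := Q₁.withDensity (φ i)) (ν := Q₂.withDensity (φ i)) |>.ae h2
    have h3 := h1'.and h2'
    refine mul_eq_zero_of_right _ ?_
    exact measure_mono_null (fun z hz hz' => hz ⟨i, hz'⟩) (ae_iff.1 h3)

/-- The expectations of a bounded function under the marginals of `γ` differ little if `γ` charges
little the set where the values of the function at the two coordinates differ notably. -/
theorem abs_integral_map_fst_sub_map_snd_le [TopologicalSpace E] [OpensMeasurableSpace E]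
    (f : BoundedContinuousFunction E ℝ) (γ : Measure (E × E)) [IsProbabilityMeasure γ]
    {B : Set (E × E)} (hB : MeasurableSet B) {ε : ℝ}
    (hε : 0 ≤ ε) (h : ∀ z ∉ B, |f z.1 - f z.2| ≤ ε) :
    |∫ x, f x ∂γ.map Prod.fst - ∫ x, f x ∂γ.map Prod.snd| ≤ ε + 2 * ‖f‖ * γ.real B := by
  have hfm : Measurable f := f.continuous.measurable
  have hi : ∀ g : E × E → E, Measurable g → Integrable (fun z => f (g z)) γ := fun g hg =>
    Integrable.of_bound (hfm.comp hg).aestronglyMeasurable ‖f‖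
      (Eventually.of_forall fun z => f.norm_coe_le_norm _)
  rw [integral_map measurable_fst.aemeasurable hfm.aestronglyMeasurable,
    integral_map measurable_snd.aemeasurable hfm.aestronglyMeasurable,
    ← integral_sub (hi _ measurable_fst) (hi _ measurable_snd)]
  refine abs_integral_le_integral_abs.trans ?_
  have hind : Integrable (B.indicator fun _ => 2 * ‖f‖) γ :=
    (integrable_const _).indicator hB
  refine (integral_mono ((hi _ measurable_fst).sub (hi _ measurable_snd)).abs
    ((integrable_const ε).add hind) fun z => ?_).trans_eq ?_
  · by_cases hz : z ∈ B
    · have h1 := f.norm_coe_le_norm z.1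
      have h2 := f.norm_coe_le_norm z.2
      have h3 := abs_sub (f z.1) (f z.2)
      rw [Real.norm_eq_abs] at h1 h2
      simp only [Pi.add_apply, Pi.sub_apply, Set.indicator_of_mem hz]
      linarith
    · simpa [hz] using h z hz
  · rw [integral_add' (integrable_const ε) hind, integral_indicator_const _ hB]
    simp [mul_comm]

end Coupling

namespace CountingMeasure

theorem wasserstein_rpow {S X : Type*} [TopologicalSpace S] [MeasurableSpace S] [MetricSpace X]
    (ι : S → X) (sα : X) {p : ℝ} (hp : p ≠ 0) (Q₁ Q₂ : Measure (CountingMeasure S)) :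
    wasserstein ι sα p Q₁ Q₂ ^ p =
      ⨅ (γ : Measure (CountingMeasure S × CountingMeasure S))
        (_ : γ.map Prod.fst = Q₁ ∧ γ.map Prod.snd = Q₂),
        ∫⁻ z, ENNReal.ofReal (D₁ ι sα z.1 z.2) ^ p ∂γ := by
  rw [wasserstein, ← ENNReal.rpow_mul, one_div, inv_mul_cancel₀ hp, ENNReal.rpow_one]

section Main

variable {S : Type*} [MetricSpace S] [CompactSpace S] [MeasurableSpace S]

/-! ### The number of points and its moments -/

theorem measurable_card : Measurable (card : CountingMeasure S → ℕ) :=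
  continuous_card.measurable

theorem measurableSet_card_eq (i : ℕ) : MeasurableSet {μ : CountingMeasure S | μ.card = i} :=
  measurable_card (measurableSet_singleton i)

theorem measurableSet_lt_card (K : ℕ) : MeasurableSet {μ : CountingMeasure S | K < μ.card} :=
  measurable_card measurableSet_Ioi

theorem lintegral_card_rpow (Q : Measure (CountingMeasure S)) (q : ℝ) :
    ∫⁻ μ, (μ.card : ℝ≥0∞) ^ q ∂Q = ∑' i : ℕ, (i : ℝ≥0∞) ^ q * Q {μ | μ.card = i} := by
  rw [← lintegral_map (f := fun i : ℕ => (i : ℝ≥0∞) ^ q) (measurable_of_countable _)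
    measurable_card, lintegral_countable']
  refine tsum_congr fun i => ?_
  rw [Measure.map_apply measurable_card (measurableSet_singleton i)]
  rfl

theorem exists_measure_lt_card_le (Q : Measure (CountingMeasure S)) [IsFiniteMeasure Q]
    {κ : ℝ≥0∞} (hκ : 0 < κ) : ∃ K : ℕ, Q {μ | K < μ.card} ≤ κ := by
  have hanti : Antitone fun K : ℕ => {μ : CountingMeasure S | K < μ.card} :=
    fun _ _ h _ hμ => lt_of_le_of_lt h hμ
  have h := tendsto_measure_iInter_atTop (μ := Q)
    (fun K => (measurableSet_lt_card K).nullMeasurableSet) hanti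
    ⟨0, measure_ne_top _ _⟩
  have hempty : ⋂ K : ℕ, {μ : CountingMeasure S | K < μ.card} = ∅ :=
    Set.eq_empty_of_forall_notMem fun μ hμ =>
      lt_irrefl μ.card (Set.mem_iInter.1 hμ μ.card)
  rw [hempty, measure_empty] at h
  obtain ⟨K, hK⟩ := (ENNReal.tendsto_nhds_zero.1 h κ hκ).exists
  exact ⟨K, hK⟩

/-- A bound on the moment of order `p₁ > p` controls the moment of order `p` of every part of small
mass: counts up to `M` contribute at most `M ^ p` times the mass. -/
theorem lintegral_card_rpow_le_of_le {Q ξ : Measure (CountingMeasure S)} (hξ : ξ ≤ Q)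
    {p p₁ : ℝ} (hp : 0 ≤ p) (hp₁ : p ≤ p₁) {B : ℝ≥0∞}
    (hB : ∫⁻ μ, (μ.card : ℝ≥0∞) ^ p₁ ∂Q ≤ B) (M : ℕ) :
    ∫⁻ μ, (μ.card : ℝ≥0∞) ^ p ∂ξ ≤
      (M : ℝ≥0∞) ^ p * ξ Set.univ + (M : ℝ≥0∞) ^ (p - p₁) * B := by
  have hmeas : Measurable fun μ : CountingMeasure S => (μ.card : ℝ≥0∞) ^ p₁ :=
    (measurable_of_countable fun i : ℕ => (i : ℝ≥0∞) ^ p₁).comp measurable_card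
  have hpt : ∀ μ : CountingMeasure S, (μ.card : ℝ≥0∞) ^ p ≤
      (M : ℝ≥0∞) ^ p + (M : ℝ≥0∞) ^ (p - p₁) * (μ.card : ℝ≥0∞) ^ p₁ := by
    intro μ
    rcases le_or_gt μ.card M with h | h
    · exact (ENNReal.rpow_le_rpow (by exact_mod_cast h) hp).trans le_self_add
    · refine le_trans ?_ le_add_self
      have h0 : (μ.card : ℝ≥0∞) ≠ 0 := by exact_mod_cast (by omega : μ.card ≠ 0)
      calc (μ.card : ℝ≥0∞) ^ p = (μ.card : ℝ≥0∞) ^ (p - p₁) * (μ.card : ℝ≥0∞) ^ p₁ := by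
            rw [← ENNReal.rpow_add _ _ h0 (ENNReal.natCast_ne_top _), sub_add_cancel]
        _ ≤ _ := by
            gcongr ?_ * _
            rw [← neg_sub p₁ p, ENNReal.rpow_neg, ENNReal.rpow_neg]
            exact ENNReal.inv_le_inv.2
              (ENNReal.rpow_le_rpow (by exact_mod_cast h.le) (sub_nonneg.2 hp₁))
  calc ∫⁻ μ, (μ.card : ℝ≥0∞) ^ p ∂ξ
      ≤ ∫⁻ μ, ((M : ℝ≥0∞) ^ p + (M : ℝ≥0∞) ^ (p - p₁) * (μ.card : ℝ≥0∞) ^ p₁) ∂ξ :=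
        lintegral_mono hpt
    _ = (M : ℝ≥0∞) ^ p * ξ Set.univ +
        (M : ℝ≥0∞) ^ (p - p₁) * ∫⁻ μ, (μ.card : ℝ≥0∞) ^ p₁ ∂ξ := by
        rw [lintegral_add_left measurable_const, lintegral_const, lintegral_const_mul _ hmeas]
    _ ≤ _ := by
        gcongr
        exact (lintegral_mono' hξ le_rfl).trans hB

omit [CompactSpace S] in
theorem tendsto_lintegral_ofReal {Q : Measure (CountingMeasure S)} [IsProbabilityMeasure Q]
    {Qs : ℕ → Measure (CountingMeasure S)} [∀ n, IsProbabilityMeasure (Qs n)]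
    (hw : ∀ f : BoundedContinuousFunction (CountingMeasure S) ℝ,
      Tendsto (fun n => ∫ μ, f μ ∂Qs n) atTop (𝓝 (∫ μ, f μ ∂Q)))
    {f : CountingMeasure S → ℝ} (hf : Continuous f) (h0 : ∀ μ, 0 ≤ f μ) (h1 : ∀ μ, f μ ≤ 1) :
    Tendsto (fun n => ∫⁻ μ, ENNReal.ofReal (f μ) ∂Qs n) atTop
      (𝓝 (∫⁻ μ, ENNReal.ofReal (f μ) ∂Q)) := by
  let g : BoundedContinuousFunction (CountingMeasure S) ℝ :=
    BoundedContinuousFunction.ofNormedAddCommGroup f hf 1 fun μ => by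
      rw [Real.norm_eq_abs, abs_of_nonneg (h0 μ)]
      exact h1 μ
  have hint : ∀ (Q' : Measure (CountingMeasure S)) [IsProbabilityMeasure Q'],
      ∫⁻ μ, ENNReal.ofReal (f μ) ∂Q' = ENNReal.ofReal (∫ μ, g μ ∂Q') := fun Q' _ =>
    (ofReal_integral_eq_lintegral_ofReal
      (Integrable.of_bound hf.measurable.aestronglyMeasurable 1 (Eventually.of_forall fun μ => by
        rw [Real.norm_eq_abs, abs_of_nonneg (h0 μ)]
        exact h1 μ)) (Eventually.of_forall h0)).symm
  simp only [hint]
  exact ENNReal.tendsto_ofReal (hw g)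

/-- Moment bounds pass to weak limits, because the events that there are exactly `i` points are
open and closed. -/
theorem lintegral_card_rpow_le_of_tendsto {Q : Measure (CountingMeasure S)}
    [IsProbabilityMeasure Q] {Qs : ℕ → Measure (CountingMeasure S)}
    [∀ n, IsProbabilityMeasure (Qs n)]
    (hw : ∀ f : BoundedContinuousFunction (CountingMeasure S) ℝ,
      Tendsto (fun n => ∫ μ, f μ ∂Qs n) atTop (𝓝 (∫ μ, f μ ∂Q)))
    {p₁ : ℝ} (hp₁ : 0 ≤ p₁) {B : ℝ≥0∞} (hB : ∀ n, ∫⁻ μ, (μ.card : ℝ≥0∞) ^ p₁ ∂Qs n ≤ B) :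
    ∫⁻ μ, (μ.card : ℝ≥0∞) ^ p₁ ∂Q ≤ B := by
  have hlim : ∀ i : ℕ, Tendsto (fun n => Qs n {μ | μ.card = i}) atTop
      (𝓝 (Q {μ | μ.card = i})) := by
    intro i
    have hc : Continuous fun μ : CountingMeasure S => if μ.card = i then (1 : ℝ) else 0 :=
      (continuous_of_discreteTopology (f := fun j : ℕ => if j = i then (1 : ℝ) else 0)).comp
        continuous_card
    have h := tendsto_lintegral_ofReal hw hc (fun μ => by split_ifs <;> norm_num)
      (fun μ => by split_ifs <;> norm_num)
    have hind : ∀ Q' : Measure (CountingMeasure S),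
        ∫⁻ μ, ENNReal.ofReal (if μ.card = i then (1 : ℝ) else 0) ∂Q' = Q' {μ | μ.card = i} := by
      intro Q'
      rw [← lintegral_indicator_one (measurableSet_card_eq i)]
      refine lintegral_congr fun μ => ?_
      by_cases hμ : μ.card = i <;> simp [hμ]
    simpa only [hind] using h
  rw [lintegral_card_rpow]
  refine ENNReal.tsum_le_of_sum_range_le fun L => ?_
  refine le_of_tendsto' (tendsto_finsetSum _ fun i _ => ENNReal.Tendsto.const_mul (hlim i)
    (Or.inr (ENNReal.rpow_ne_top_of_nonneg hp₁ (ENNReal.natCast_ne_top i)))) fun n => ?_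
  exact (ENNReal.sum_le_tsum _).trans ((lintegral_card_rpow _ _).symm.trans_le (hB n))

/-! ### Wasserstein convergence and weak convergence -/

variable [BorelSpace S] {X : Type*} [MetricSpace X]

/-- Continuous functions of small `D₁`-diameter of support, finitely many of which sum to `1` on
the compact set of measures with at most `K` points. They are normalized hat functions
`max 0 (r - D₁ ξ ·)` around the centres `ξ` of a finite net. -/
theorem exists_subpartition_of_unity {ι : S → X} (hι : Isometry ι) {sα : X} {a : ℝ} (ha0 : 0 < a)
    (ha : ∀ s, a ≤ dist (ι s) sα) (K : ℕ) {ε : ℝ} (hε : 0 < ε) :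
    ∃ (t : Finset (CountingMeasure S)) (φ : t → CountingMeasure S → ℝ),
      (∀ i, Continuous (φ i)) ∧ (∀ i μ, 0 ≤ φ i μ) ∧ (∀ μ, ∑ i, φ i μ ≤ 1) ∧
      (∀ μ, μ.card ≤ K → ∑ i, φ i μ = 1) ∧
      ∀ i μ ν, φ i μ ≠ 0 → φ i ν ≠ 0 → D₁ ι sα μ ν < ε := by
  set r := min a (ε / 2)
  have hr0 : 0 < r := lt_min ha0 (by positivity)
  have hD : ∀ ξ, Continuous (D₁ ι sα ξ) := fun ξ =>
    (continuous_D₁ hι sα).comp (continuous_const.prodMk continuous_id)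
  obtain ⟨t, ht⟩ := (isCompact_card_le (S := S) K).elim_finite_subcover
    (fun ξ => {ν | D₁ ι sα ξ ν < r}) (fun ξ => isOpen_lt (hD ξ) continuous_const)
    (fun μ _ => Set.mem_iUnion.2 ⟨μ, by simpa [D₁_self hι] using hr0⟩)
  let ψ (i : t) (μ : CountingMeasure S) : ℝ := max 0 (r - D₁ ι sα i μ)
  -- The last summand keeps the denominator positive where the hat functions vanish.
  let d (μ : CountingMeasure S) : ℝ := ∑ i, ψ i μ + if μ.card ≤ K then 0 else 1
  have hψ0 : ∀ i μ, 0 ≤ ψ i μ := fun i μ => le_max_left _ _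
  have hψc : ∀ i, Continuous (ψ i) := fun i =>
    continuous_const.max (continuous_const.sub (hD i))
  have hψD : ∀ i μ, ψ i μ ≠ 0 → D₁ ι sα i μ < r := by
    intro i μ h
    by_contra hcon
    exact h (max_eq_left (by linarith))
  have hdc : Continuous d := (continuous_finsetSum _ fun i _ => hψc i).add
    ((continuous_of_discreteTopology (f := fun j : ℕ => if j ≤ K then (0 : ℝ) else 1)).comp
      continuous_card)
  have hsum0 : ∀ μ, 0 ≤ ∑ i, ψ i μ := fun μ => Finset.sum_nonneg fun i _ => hψ0 i μ
  have hle : ∀ μ, ∑ i, ψ i μ ≤ d μ := fun μ => by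
    simp only [d]
    split_ifs <;> simp
  have hd0 : ∀ μ, 0 < d μ := by
    intro μ
    by_cases hμ : μ.card ≤ K
    · obtain ⟨ξ, hξt, hξ⟩ : ∃ ξ ∈ t, D₁ ι sα ξ μ < r := by simpa using ht hμ
      refine lt_of_lt_of_le ?_ (hle μ)
      refine Finset.sum_pos' (fun i _ => hψ0 i μ) ⟨⟨ξ, hξt⟩, Finset.mem_univ _, ?_⟩
      exact lt_max_of_lt_right (sub_pos.2 hξ)
    · simp only [d, if_neg hμ]
      linarith [hsum0 μ]
  refine ⟨t, fun i μ => ψ i μ / d μ, fun i => (hψc i).div hdc fun μ => (hd0 μ).ne',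
    fun i μ => div_nonneg (hψ0 i μ) (hd0 μ).le, fun μ => ?_, fun μ hμ => ?_, fun i μ ν hμ hν => ?_⟩
  · rw [← Finset.sum_div]
    exact (div_le_one (hd0 μ)).2 (hle μ)
  · rw [← Finset.sum_div]
    simp only [d, if_pos hμ, add_zero]
    have := hd0 μ
    simp only [d, if_pos hμ, add_zero] at this
    exact div_self this.ne'
  · have h1 := hψD i μ (div_ne_zero_iff.1 hμ).1
    have h2 := hψD i ν (div_ne_zero_iff.1 hν).1
    have hra : r ≤ a := min_le_left _ _
    have hre : r ≤ ε / 2 := min_le_right _ _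
    have h3 := D₁_le_add_of_card_eq hι sα (card_eq_of_D₁_lt ha (h1.trans_le hra)).symm
      (card_eq_of_D₁_lt ha (h2.trans_le hra)).symm
    linarith

theorem tendsto_integral_of_tendsto_wasserstein {ι : S → X} (hι : Isometry ι) {sα : X} {a : ℝ}
    (ha0 : 0 < a) (ha : ∀ s, a ≤ dist (ι s) sα) {p : ℝ} (hp : 0 < p)
    {Q : Measure (CountingMeasure S)} [IsProbabilityMeasure Q]
    {Qs : ℕ → Measure (CountingMeasure S)} [∀ n, IsProbabilityMeasure (Qs n)]
    (hW : Tendsto (fun n => wasserstein ι sα p (Qs n) Q ^ p) atTop (𝓝 0))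
    (f : BoundedContinuousFunction (CountingMeasure S) ℝ) :
    Tendsto (fun n => ∫ μ, f μ ∂Qs n) atTop (𝓝 (∫ μ, f μ ∂Q)) := by
  rw [Metric.tendsto_atTop']
  intro ε hε
  -- The exceptional event of the coupling will have probability at most `2 * κ`, and the integrand
  -- is at most `2 * ‖f‖` there.
  set κ : ℝ := ε / 2 / (4 * ‖f‖ + 1) with hκ
  have hκ0 : 0 < κ := by positivity
  have hκε : 4 * ‖f‖ * κ < ε / 2 := by
    rw [hκ, mul_div_assoc', div_lt_iff₀ (by positivity)]
    nlinarith [norm_nonneg f]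
  obtain ⟨K, hK⟩ := exists_measure_lt_card_le Q (ENNReal.ofReal_pos.2 hκ0)
  obtain ⟨δ, hδ0, hδ⟩ := exists_pos_forall_D₁_lt hι ha0 ha f.continuous K (half_pos hε)
  have hδp : ENNReal.ofReal δ ^ p ≠ 0 := (ENNReal.rpow_pos (by simpa) (by simp)).ne'
  have hδp' : ENNReal.ofReal δ ^ p ≠ ∞ := ENNReal.rpow_ne_top_of_nonneg hp.le (by simp)
  have hη : 0 < ENNReal.ofReal δ ^ p * ENNReal.ofReal κ :=
    ENNReal.mul_pos hδp (ENNReal.ofReal_pos.2 hκ0).ne'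
  have hev := (tendsto_order.1 hW).2 _ hη
  obtain ⟨N, hN⟩ := eventually_atTop.1 hev
  refine ⟨N, fun n hn => ?_⟩
  have hlt := hN n hn.le
  rw [wasserstein_rpow ι sα hp.ne'] at hlt
  simp only [iInf_lt_iff] at hlt
  obtain ⟨γ, ⟨h1, h2⟩, hγ⟩ := hlt
  have hprob : IsProbabilityMeasure γ := ⟨by
    rw [← Set.preimage_univ (f := Prod.fst), ← Measure.map_apply measurable_fst .univ, h1,
      measure_univ]⟩
  have hDm : Measurable fun z : CountingMeasure S × CountingMeasure S =>
      ENNReal.ofReal (D₁ ι sα z.1 z.2) ^ p :=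
    ((continuous_D₁ hι sα).measurable.ennreal_ofReal).pow_const p
  set B₁ : Set (CountingMeasure S × CountingMeasure S) := Prod.snd ⁻¹' {μ | K < μ.card}
  set B₂ : Set (CountingMeasure S × CountingMeasure S) := {z |
    ENNReal.ofReal δ ^ p ≤ ENNReal.ofReal (D₁ ι sα z.1 z.2) ^ p}
  have hB₁ : MeasurableSet B₁ :=
    measurable_snd (measurableSet_lt_card K)
  have hB₂ : MeasurableSet B₂ := measurableSet_le measurable_const hDm
  have hγ₁ : γ B₁ ≤ ENNReal.ofReal κ := by
    rw [← Measure.map_apply measurable_snd (measurableSet_lt_card K), h2]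
    exact hK
  have hγ₂ : γ B₂ ≤ ENNReal.ofReal κ := by
    have h := (mul_meas_ge_le_lintegral hDm (ENNReal.ofReal δ ^ p)).trans hγ.le
    exact (ENNReal.mul_le_mul_iff_right hδp hδp').1 h
  have hγB : γ.real (B₁ ∪ B₂) ≤ 2 * κ := by
    refine (measureReal_union_le _ _).trans ?_
    have k1 := ENNReal.toReal_le_of_le_ofReal hκ0.le hγ₁
    have k2 := ENNReal.toReal_le_of_le_ofReal hκ0.le hγ₂
    simp only [Measure.real]
    linarith
  have key := abs_integral_map_fst_sub_map_snd_le f γ (hB₁.union hB₂) (half_pos hε).le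
    fun z hz => by
      rw [Set.mem_union, not_or] at hz
      refine (hδ z.1 z.2 (not_lt.1 hz.1) ?_).le
      by_contra hcon
      exact hz.2 (ENNReal.rpow_le_rpow (ENNReal.ofReal_le_ofReal (not_lt.1 hcon)) hp.le)
  rw [h1, h2] at key
  rw [Real.dist_eq]
  nlinarith [norm_nonneg f]

omit [BorelSpace S] in
/-- The coupling bound: measures close to each other in `D₁` are coupled along a subpartition of
unity at cost at most `ε ^ p`, and the remaining mass `r` is coupled at a cost controlled by the
moments of order `p₁ > p`. -/
theorem wasserstein_rpow_le {ι : S → X} {sα : X} {C : ℝ}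
    (hC : ∀ u ∈ insert sα (Set.range ι), ∀ v ∈ insert sα (Set.range ι), dist u v ≤ C)
    {p p₁ : ℝ} (hp : 0 < p) (hp₁ : p ≤ p₁) {B : ℝ≥0∞}
    {Q₁ Q₂ : Measure (CountingMeasure S)} [IsProbabilityMeasure Q₁] [IsProbabilityMeasure Q₂]
    (hB₁ : ∫⁻ μ, (μ.card : ℝ≥0∞) ^ p₁ ∂Q₁ ≤ B) (hB₂ : ∫⁻ μ, (μ.card : ℝ≥0∞) ^ p₁ ∂Q₂ ≤ B)
    {J : Type*} [Fintype J] {φ : J → CountingMeasure S → ℝ≥0∞} (hφ : ∀ i, Measurable (φ i))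
    (hsum : ∀ μ, ∑ i, φ i μ ≤ 1) {ε : ℝ}
    (hε : ∀ i μ ν, φ i μ ≠ 0 → φ i ν ≠ 0 → D₁ ι sα μ ν < ε) (M : ℕ) :
    wasserstein ι sα p Q₁ Q₂ ^ p ≤ ENNReal.ofReal ε ^ p +
      2 * ENNReal.ofReal C ^ p *
        ((M : ℝ≥0∞) ^ p * (1 - ∑ i, min (∫⁻ μ, φ i μ ∂Q₁) (∫⁻ μ, φ i μ ∂Q₂)) +
          (M : ℝ≥0∞) ^ (p - p₁) * B) := by
  obtain ⟨γ₀, hγ₁, hγ₂, hmass, hae⟩ := exists_partial_coupling Q₁ Q₂ φ hφ hsum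
  obtain ⟨R, h1, h2, hR₁, hR₂, hR⟩ := exists_coupling_add Q₁ Q₂ hγ₁ hγ₂
  rw [← hmass, ← hR, wasserstein_rpow ι sα hp.ne']
  refine (iInf₂_le (γ₀ + R) ⟨h1, h2⟩).trans ?_
  rw [lintegral_add_measure]
  refine add_le_add ?_ ?_
  · have hγ₀ : γ₀ Set.univ ≤ 1 := by
      rw [← Set.preimage_univ (f := Prod.fst), ← Measure.map_apply measurable_fst .univ,
        ← measure_univ (μ := Q₁)]
      exact hγ₁ _
    calc ∫⁻ z, ENNReal.ofReal (D₁ ι sα z.1 z.2) ^ p ∂γ₀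
        ≤ ∫⁻ _, ENNReal.ofReal ε ^ p ∂γ₀ := by
          refine lintegral_mono_ae (hae.mono fun z ⟨i, hi, hi'⟩ => ?_)
          exact ENNReal.rpow_le_rpow (ENNReal.ofReal_le_ofReal (hε i _ _ hi hi').le) hp.le
      _ = ENNReal.ofReal ε ^ p * γ₀ Set.univ := lintegral_const _
      _ ≤ ENNReal.ofReal ε ^ p := mul_le_of_le_one_right' hγ₀
  · have hmeas : Measurable fun μ : CountingMeasure S => (μ.card : ℝ≥0∞) ^ p :=
      (measurable_of_countable fun i : ℕ => (i : ℝ≥0∞) ^ p).comp measurable_card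
    have hpt : ∀ z : CountingMeasure S × CountingMeasure S,
        ENNReal.ofReal (D₁ ι sα z.1 z.2) ^ p ≤
          ENNReal.ofReal C ^ p * ((z.1.card : ℝ≥0∞) ^ p + (z.2.card : ℝ≥0∞) ^ p) := by
      intro z
      have h := ENNReal.ofReal_le_ofReal (D₁_le_mul_max hC z.1 z.2)
      rw [ENNReal.ofReal_mul' (by positivity), ENNReal.ofReal_natCast] at h
      refine (ENNReal.rpow_le_rpow h hp.le).trans ?_
      rw [ENNReal.mul_rpow_of_nonneg _ _ hp.le]
      gcongr
      rcases le_total z.1.card z.2.card with hc | hc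
      · rw [max_eq_right hc]
        exact le_add_self
      · rw [max_eq_left hc]
        exact le_self_add
    have hm1 := lintegral_card_rpow_le_of_le hR₁ hp.le hp₁ hB₁ M
    have hm2 := lintegral_card_rpow_le_of_le hR₂ hp.le hp₁ hB₂ M
    rw [lintegral_map hmeas measurable_fst, Measure.map_apply measurable_fst .univ,
      Set.preimage_univ] at hm1
    rw [lintegral_map hmeas measurable_snd, Measure.map_apply measurable_snd .univ,
      Set.preimage_univ] at hm2
    refine (lintegral_mono hpt).trans ?_
    have hfst : Measurable fun z : CountingMeasure S × CountingMeasure S =>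
        (z.1.card : ℝ≥0∞) ^ p := hmeas.comp measurable_fst
    rw [lintegral_const_mul' _ _ (ENNReal.rpow_ne_top_of_nonneg hp.le ENNReal.ofReal_ne_top),
      lintegral_add_left hfst]
    refine (mul_le_mul_right (add_le_add hm1 hm2) _).trans_eq ?_
    ring

theorem tendsto_wasserstein_of_tendsto_integral {ι : S → X} (hι : Isometry ι) {sα : X} {a : ℝ}
    (ha0 : 0 < a) (ha : ∀ s, a ≤ dist (ι s) sα) {p p₁ : ℝ} (hp : 0 < p) (hp₁ : p < p₁)
    {Q : Measure (CountingMeasure S)} [IsProbabilityMeasure Q]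
    {Qs : ℕ → Measure (CountingMeasure S)} [∀ n, IsProbabilityMeasure (Qs n)]
    {B : ℝ≥0∞} (hBtop : B ≠ ∞) (hB : ∀ n, ∫⁻ μ, (μ.card : ℝ≥0∞) ^ p₁ ∂Qs n ≤ B)
    (hw : ∀ f : BoundedContinuousFunction (CountingMeasure S) ℝ,
      Tendsto (fun n => ∫ μ, f μ ∂Qs n) atTop (𝓝 (∫ μ, f μ ∂Q))) :
    Tendsto (fun n => wasserstein ι sα p (Qs n) Q ^ p) atTop (𝓝 0) := by
  have hBQ := lintegral_card_rpow_le_of_tendsto hw (hp.le.trans hp₁.le) hB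
  obtain ⟨C, hC⟩ : ∃ C : ℝ, ∀ u ∈ insert sα (Set.range ι), ∀ v ∈ insert sα (Set.range ι),
      dist u v ≤ C :=
    ⟨Metric.diam (insert sα (Set.range ι)), fun u hu v hv => Metric.dist_le_diam_of_mem
      ((isCompact_range hι.continuous).insert sα).isBounded hu hv⟩
  set c : ℝ≥0∞ := 2 * ENNReal.ofReal C ^ p
  have hctop : c ≠ ∞ := ENNReal.mul_ne_top (by simp)
    (ENNReal.rpow_ne_top_of_nonneg hp.le ENNReal.ofReal_ne_top)
  rw [ENNReal.tendsto_nhds_zero]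
  intro δ hδ
  have hδ3 : 0 < δ / 3 := ENNReal.div_pos hδ.ne' (by simp)
  -- The distance `ε` below which measures are considered close to each other.
  obtain ⟨ε, hε0, hε⟩ : ∃ ε : ℝ, 0 < ε ∧ ENNReal.ofReal ε ^ p ≤ δ / 3 := by
    have h : Tendsto (fun ε : ℝ => ENNReal.ofReal ε ^ p) (𝓝[>] 0) (𝓝 0) := by
      have := ((ENNReal.continuous_rpow_const (y := p)).comp
        ENNReal.continuous_ofReal).tendsto (0 : ℝ)
      simp only [Function.comp_def, ENNReal.ofReal_zero, ENNReal.zero_rpow_of_pos hp] at this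
      exact this.mono_left nhdsWithin_le_nhds
    obtain ⟨ε, h1, h2⟩ := ((ENNReal.tendsto_nhds_zero.1 h _ hδ3).and self_mem_nhdsWithin).exists
    exact ⟨ε, h2, h1⟩
  -- The number `M` of points beyond which the moment bound is used.
  obtain ⟨M, hM⟩ : ∃ M : ℕ, c * ((M : ℝ≥0∞) ^ (p - p₁) * B) ≤ δ / 3 := by
    have h : Tendsto (fun M : ℕ => c * ((M : ℝ≥0∞) ^ (p - p₁) * B)) atTop (𝓝 0) := by
      have h1 : Tendsto (fun M : ℕ => (M : ℝ≥0∞) ^ (p - p₁)) atTop (𝓝 0) := by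
        have h2 := (ENNReal.tendsto_rpow_at_top (sub_pos.2 hp₁)).comp
          ENNReal.tendsto_nat_nhds_top
        have h3 := tendsto_inv_iff.2 h2
        simp only [ENNReal.inv_top] at h3
        refine h3.congr fun M => ?_
        rw [← neg_sub p₁ p, ENNReal.rpow_neg]
        rfl
      have h2 := ENNReal.Tendsto.const_mul
        (ENNReal.Tendsto.mul_const h1 (Or.inr hBtop)) (Or.inr hctop)
      simpa using h2
    exact (ENNReal.tendsto_nhds_zero.1 h _ hδ3).exists
  -- The number `K` of points beyond which `Q` has little mass.
  set d : ℝ≥0∞ := c * (M : ℝ≥0∞) ^ p with hd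
  have hdtop : d ≠ ∞ := ENNReal.mul_ne_top hctop
    (ENNReal.rpow_ne_top_of_nonneg hp.le (ENNReal.natCast_ne_top M))
  have hκ : 0 < δ / 3 / (d + 1) := ENNReal.div_pos hδ3.ne' (by simp [hdtop])
  obtain ⟨κ, hκ0, hκlt⟩ := exists_between hκ
  obtain ⟨K, hK⟩ := exists_measure_lt_card_le Q hκ0
  obtain ⟨t, φ, hφc, hφ0, hφ1, hφK, hφε⟩ := exists_subpartition_of_unity hι ha0 ha K hε0
  have hle1 : ∀ i μ, φ i μ ≤ 1 := fun i μ =>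
    (Finset.single_le_sum (f := fun i => φ i μ) (fun i _ => hφ0 i μ) (Finset.mem_univ i)).trans
      (hφ1 μ)
  have hsum : ∀ μ, ∑ i, ENNReal.ofReal (φ i μ) = ENNReal.ofReal (∑ i, φ i μ) := fun μ =>
    (ENNReal.ofReal_sum_of_nonneg fun i _ => hφ0 i μ).symm
  set r : ℕ → ℝ≥0∞ := fun n => 1 - ∑ i, min (∫⁻ μ, ENNReal.ofReal (φ i μ) ∂Qs n)
    (∫⁻ μ, ENNReal.ofReal (φ i μ) ∂Q) with hr
  have hrlim : Tendsto r atTop (𝓝 (1 - ∑ i, ∫⁻ μ, ENNReal.ofReal (φ i μ) ∂Q)) := by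
    refine ENNReal.Tendsto.sub tendsto_const_nhds (tendsto_finsetSum _ fun i _ => ?_)
      (Or.inl ENNReal.one_ne_top)
    have := (tendsto_lintegral_ofReal hw (hφc i) (hφ0 i) (hle1 i)).min
      (tendsto_const_nhds (x := ∫⁻ μ, ENNReal.ofReal (φ i μ) ∂Q))
    rwa [min_self] at this
  have hrK : 1 - ∑ i, ∫⁻ μ, ENNReal.ofReal (φ i μ) ∂Q ≤ κ := by
    rw [tsub_le_iff_left, ← lintegral_finsetSum _ fun i _ => (hφc i).measurable.ennreal_ofReal]
    simp only [hsum]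
    calc (1 : ℝ≥0∞) = Q Set.univ := measure_univ.symm
      _ ≤ Q ({μ | K < μ.card}ᶜ ∪ {μ | K < μ.card}) := by rw [Set.compl_union_self]
      _ ≤ Q {μ | K < μ.card}ᶜ + Q {μ | K < μ.card} := measure_union_le _ _
      _ ≤ _ := by
        refine add_le_add ?_ hK
        rw [← lintegral_indicator_one (measurableSet_lt_card K).compl]
        refine lintegral_mono fun μ => ?_
        by_cases hμ : μ ∈ {μ : CountingMeasure S | K < μ.card}ᶜ
        · rw [Set.indicator_of_mem hμ, hφK μ (not_lt.1 hμ)]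
          simp
        · simp [Set.indicator_of_notMem hμ]
  have hev : ∀ᶠ n in atTop, r n < δ / 3 / (d + 1) :=
    hrlim.eventually_lt_const (hrK.trans_lt hκlt)
  filter_upwards [hev] with n hn
  have hdr : d * r n ≤ δ / 3 := calc
    d * r n ≤ (d + 1) * (δ / 3 / (d + 1)) := mul_le_mul' le_self_add hn.le
    _ ≤ δ / 3 := ENNReal.mul_div_le
  have key := wasserstein_rpow_le hC hp hp₁.le (hB n) hBQ
    (φ := fun i μ => ENNReal.ofReal (φ i μ)) (fun i => (hφc i).measurable.ennreal_ofReal)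
    (fun μ => by rw [hsum]; exact ENNReal.ofReal_le_one.2 (hφ1 μ))
    (fun i μ ν hμ hν => hφε i μ ν (fun h => hμ (by simp [h])) (fun h => hν (by simp [h]))) M
  calc wasserstein ι sα p (Qs n) Q ^ p
      ≤ ENNReal.ofReal ε ^ p + c * ((M : ℝ≥0∞) ^ p * r n + (M : ℝ≥0∞) ^ (p - p₁) * B) := key
    _ = ENNReal.ofReal ε ^ p + d * r n + c * ((M : ℝ≥0∞) ^ (p - p₁) * B) := by
      rw [hd]
      ring
    _ ≤ δ / 3 + δ / 3 + δ / 3 := by gcongr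
    _ = δ := ENNReal.add_thirds δ

end Main

end CountingMeasure

theorem proposition2
    -- a compact metric space `S`, contained in a metric space `X` with a further point `sα`
    {S X : Type*} [MetricSpace S] [CompactSpace S] [MeasurableSpace S] [BorelSpace S]
    [MetricSpace X] (ι : S → X) (hι : Isometry ι)
    (sα : X) (hsα : sα ∉ Set.range ι) (α : ℝ) (hα : ⨅ s, dist (ι s) sα = α)
    (p : ℝ) (hp : 1 ≤ p)
    -- point processes `η₀, η₁, …` and `η`, possibly on different probability spaces
    {Ω : ℕ → Type*} [∀ n, MeasurableSpace (Ω n)]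
    (P : ∀ n, Measure (Ω n)) [∀ n, IsProbabilityMeasure (P n)]
    {Ω' : Type*} [MeasurableSpace Ω'] (P' : Measure Ω') [IsProbabilityMeasure P']
    (ηs : ∀ n, Ω n → CountingMeasure S) (hηs : ∀ n, Measurable (ηs n))
    (η : Ω' → CountingMeasure S) (hη : Measurable η) :
    (Tendsto (fun n => CountingMeasure.wasserstein ι sα p ((P n).map (ηs n)) (P'.map η) ^ p)
        atTop (𝓝 0) →
      ∀ f : BoundedContinuousFunction (CountingMeasure S) ℝ,
        Tendsto (fun n => ∫ ω, f (ηs n ω) ∂(P n)) atTop (𝓝 (∫ ω, f (η ω) ∂P'))) ∧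
    (∀ p₁ : ℝ, p < p₁ →
      (⨆ n, ∑' i : ℕ, (i : ℝ≥0∞) ^ p₁ * P n {ω | (ηs n ω).card = i}) < ∞ →
      (∀ f : BoundedContinuousFunction (CountingMeasure S) ℝ,
        Tendsto (fun n => ∫ ω, f (ηs n ω) ∂(P n)) atTop (𝓝 (∫ ω, f (η ω) ∂P'))) →
      Tendsto (fun n => CountingMeasure.wasserstein ι sα p ((P n).map (ηs n)) (P'.map η) ^ p)
        atTop (𝓝 0)) := by
  obtain ⟨a, ha0, ha⟩ := CountingMeasure.exists_pos_forall_le_dist hι hsα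
  have hp0 : 0 < p := one_pos.trans_le hp
  have hPs : ∀ n, IsProbabilityMeasure ((P n).map (ηs n)) := fun n =>
    Measure.isProbabilityMeasure_map (hηs n).aemeasurable
  have hP : IsProbabilityMeasure (P'.map η) := Measure.isProbabilityMeasure_map hη.aemeasurable
  have hint : ∀ f : BoundedContinuousFunction (CountingMeasure S) ℝ,
      Tendsto (fun n => ∫ ω, f (ηs n ω) ∂(P n)) atTop (𝓝 (∫ ω, f (η ω) ∂P')) ↔
      Tendsto (fun n => ∫ μ, f μ ∂(P n).map (ηs n)) atTop (𝓝 (∫ μ, f μ ∂P'.map η)) := by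
    intro f
    have hf : ∀ Q : Measure (CountingMeasure S), AEStronglyMeasurable f Q := fun Q =>
      f.continuous.measurable.aestronglyMeasurable
    rw [integral_map hη.aemeasurable (hf _)]
    simp only [integral_map (hηs _).aemeasurable (hf _)]
  simp only [hint]
  refine ⟨fun hW f =>
    CountingMeasure.tendsto_integral_of_tendsto_wasserstein hι ha0 ha hp0 hW f,
    fun p₁ hp₁ hB hw => CountingMeasure.tendsto_wasserstein_of_tendsto_integral hι ha0 ha hp0 hp₁
      hB.ne (fun n => ?_) hw⟩
  refine le_trans (le_of_eq ?_) (le_iSup _ n)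
  rw [CountingMeasure.lintegral_card_rpow]
  refine tsum_congr fun i => ?_
  rw [Measure.map_apply (hηs n) (CountingMeasure.measurableSet_card_eq i)]
  rfl
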